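/- Let $\rho,\sigma$ be density operators on a finite-dimensional complex Hilbert space $\mathcal H$. For $\varepsilon\ge 0$ let $D_h^{\varepsilon}(\rho^{\otimes n}\|\sigma^{\otimes n})=-\log\beta_\varepsilon(\rho^{\otimes n},\sigma^{\otimes n})\in[0,+\infty]$ be the hypothesis testing relative entropy, where $$\beta_\varepsilon(\rho^{\otimes n},\sigma^{\otimes n})=\inf\bigl\{\operatorname{Tr}[(I-\Pi)\sigma^{\otimes n}] : 0\preceq\Pi\preceq I,\ \operatorname{Tr}[\Pi\rho^{\otimes n}]\le\varepsilon\bigr\}$$ is the smallest type-II error of a test on $\mathcal H^{\otimes n}$ whose type-I error is at most $\varepsilon$. Logarithms are natural, $\log 0=-\infty$, and the zeroth power of a positive semidefinite operator is the projection onto its support. Let $r\in\mathbb R$ with $e^{-r}\neq\operatorname{Tr}[\rho\,\Pi_\sigma]$, where $\Pi_\sigma$ is the projection onto the support of $\sigma$ (when $\operatorname{supp}\rho\subseteq\operatorname{supp}\sigma$ this just says $r\neq 0$), and let $(\varepsilon_n)$ satisfy $0\le\varepsilon_n\le e^{-nr}$ for all $n$. Then, in the extended reals, $$\limsup_{n\to\infty}\frac1n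 D_h^{\varepsilon_n}(\rho^{\otimes n}\|\sigma^{\otimes n})\;\le\;\sup_{0\le s<1}\left\{\frac{1}{s-1}\log\operatorname{Tr}\bigl[\rho^s\sigma^{1-s}\bigr]+\frac{s}{s-1}\,r\right\}.$$ -/

import Mathlib

open Filter
open scoped ComplexOrder

/-- A density operator on `ℂ^ι`: positive semidefinite (hence self-adjoint) with unit trace. -/
def IsDensityOperator {ι : Type*} [Fintype ι] (ρ : Matrix ι ι ℂ) : Prop :=
  ρ.PosSemidef ∧ ρ.trace = 1

/-- The `n`-fold tensor (Kronecker) power `ρ^{⊗n}`, acting on `(ℂ^ι)^{⊗n} = ℂ^(ι^n)`. -/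
def tensorPower {ι : Type*} (ρ : Matrix ι ι ℂ) (n : ℕ) :
    Matrix (Fin n → ι) (Fin n → ι) ℂ :=
  Matrix.of fun f g => ∏ k, ρ (f k) (g k)

/-- A binary test: an operator `T` with `0 ⪯ T ⪯ I`; `T` is the effect accepting `H₁`. -/
def IsTest {ι : Type*} [DecidableEq ι] (T : Matrix ι ι ℂ) : Prop :=
  T.PosSemidef ∧ (1 - T).PosSemidef

/-- Type-I error probability `Tr[T ρ]` (accepting `H₁` when the state is `ρ`). -/
noncomputable def typeIError {ι : Type*} [Fintype ι] (ρ T : Matrix ι ι ℂ) : ℝ :=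
  (T * ρ).trace.re

/-- Type-II error probability `Tr[(I - T) σ]` (accepting `H₀` when the state is `σ`). -/
noncomputable def typeIIError {ι : Type*} [Fintype ι] [DecidableEq ι]
    (σ T : Matrix ι ι ℂ) : ℝ :=
  ((1 - T) * σ).trace.re

/-- Optimal trade-off `β_α(ρ, σ)`: the infimum of the type-II error over all tests with type-I
error at most `α`. For `α ≥ 0` the set is nonempty (it contains `T = 0`) and, for positive
semidefinite `σ`, bounded below by `0`. -/
noncomputable def optimalTypeII {ι : Type*} [Fintype ι] [DecidableEq ι]
    (α : ℝ) (ρ σ : Matrix ι ι ℂ) : ℝ :=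
  sInf {b : ℝ | ∃ T : Matrix ι ι ℂ, IsTest T ∧ typeIError ρ T ≤ α ∧ b = typeIIError σ T}

/-- Natural logarithm of a nonnegative real as an extended real, with `log 0 = -∞`. -/
noncomputable def extLog (x : ℝ) : EReal := ENNReal.log (ENNReal.ofReal x)

/-- Hypothesis testing relative entropy `D_h^ε(ρ‖σ) = -log β_ε(ρ, σ)`, equal to `+∞` when
`β_ε(ρ, σ) = 0`. -/
noncomputable def hypTestEntropy {ι : Type*} [Fintype ι] [DecidableEq ι]
    (ε : ℝ) (ρ σ : Matrix ι ι ℂ) : EReal :=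
  -extLog (optimalTypeII ε ρ σ)

/-- The power `A ^ s` (`s ≥ 0`) of a positive semidefinite matrix, through the functional calculus
of the function `x ↦ x ^ s` for `x > 0`, `0 ↦ 0`. In particular `A ^ 0` is the orthogonal
projection onto the support of `A`. -/
noncomputable def psdPow {ι : Type*} [Fintype ι] [DecidableEq ι]
    (A : Matrix ι ι ℂ) (s : ℝ) : Matrix ι ι ℂ :=
  cfc (fun x : ℝ => if x = 0 then 0 else x ^ s) A

/-- The orthogonal projection onto the support (range) of a positive semidefinite matrix. -/
noncomputable def supportProj {ι : Type*} [Fintype ι] [DecidableEq ι]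
    (A : Matrix ι ι ℂ) : Matrix ι ι ℂ :=
  psdPow A 0

/-- The Hoeffding exponent
`sup_{0 ≤ s < 1} { (1/(s-1)) log Tr[ρ^s σ^(1-s)] + (s/(s-1)) r }`, an extended real. -/
noncomputable def hoeffdingExponent {ι : Type*} [Fintype ι] [DecidableEq ι]
    (ρ σ : Matrix ι ι ℂ) (r : ℝ) : EReal :=
  ⨆ s ∈ Set.Ico (0 : ℝ) 1,
    ((1 / (s - 1) : ℝ) : EReal) * extLog (psdPow ρ s * psdPow σ (1 - s)).trace.re
      + ((s / (s - 1) * r : ℝ) : EReal)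

/-! If a real z exceeds the Hoeffding exponent, then e^{sr+(1-s)z} Tr[ρ^s σ^{1-s}] > 1 for 0 ≤ s <
1. Continuity gives ≥ 1 at s = 1, where equality would mean e^{-r} = Tr[ρ Π_σ], the excluded case.

By Nussbaum–Szkoła (`exists_nussbaumSzkola_weights`) the trace is the Chernoff sum of classical
weights p, q, and 2(e^{nr}·type I + e^{nz}·type II) dominates the overlap of the n-fold products of
e^r p and e^z q. Their Chernoff function exceeds 1 on the compact [0,1], so the overlap diverges
(`tendsto_sum_min_prod_atTop`: tilt at the minimiser, then Chebyshev). Since e^{nr} ε_n ≤ 1, the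
type-II error is eventually at least e^{-nz}. -/

/-! ### Powers on the support and the Chernoff function -/

/-- The function `x ↦ x ^ s` with the convention `0 ↦ 0` for every exponent. -/
noncomputable def suppRpow (s x : ℝ) : ℝ := if x = 0 then 0 else x ^ s

/-- The integrand `p ^ s * q ^ (1 - s)` of the Chernoff function, supported where `p, q ≠ 0`. -/
noncomputable def chernoffTerm (p q s : ℝ) : ℝ := suppRpow s p * suppRpow (1 - s) q

lemma suppRpow_nonneg {x : ℝ} (s : ℝ) (hx : 0 ≤ x) : 0 ≤ suppRpow s x := by
  unfold suppRpow
  split_ifs <;> positivity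

lemma suppRpow_mul {x y : ℝ} (s : ℝ) (hx : 0 ≤ x) (hy : 0 ≤ y) :
    suppRpow s (x * y) = suppRpow s x * suppRpow s y := by
  unfold suppRpow
  by_cases h1 : x = 0
  · simp [h1]
  by_cases h2 : y = 0
  · simp [h2]
  simp [h1, h2, Real.mul_rpow hx hy]

lemma chernoffTerm_nonneg {p q : ℝ} (s : ℝ) (hp : 0 ≤ p) (hq : 0 ≤ q) :
    0 ≤ chernoffTerm p q s :=
  mul_nonneg (suppRpow_nonneg _ hp) (suppRpow_nonneg _ hq)

lemma chernoffTerm_eq_exp {p q : ℝ} (s : ℝ) (hp : 0 < p) (hq : 0 < q) :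
    chernoffTerm p q s = Real.exp (s * Real.log p + (1 - s) * Real.log q) := by
  rw [chernoffTerm, suppRpow, suppRpow, if_neg hp.ne', if_neg hq.ne', Real.exp_add,
    Real.rpow_def_of_pos hp, Real.rpow_def_of_pos hq, mul_comm s, mul_comm (1 - s)]

lemma chernoffTerm_eq_zero {p q : ℝ} (s : ℝ) (h : p = 0 ∨ q = 0) : chernoffTerm p q s = 0 := by
  rcases h with h | h <;> simp [chernoffTerm, suppRpow, h]

lemma chernoffTerm_mul {a b p q : ℝ} (s : ℝ) (ha : 0 < a) (hb : 0 < b) (hp : 0 ≤ p)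
    (hq : 0 ≤ q) : chernoffTerm (a * p) (b * q) s = a ^ s * b ^ (1 - s) * chernoffTerm p q s := by
  rw [chernoffTerm, suppRpow_mul _ ha.le hp, suppRpow_mul _ hb.le hq, chernoffTerm]
  simp only [suppRpow, ha.ne', hb.ne', if_false]
  ring

/-- The junk value `Real.log 0 = 0` is harmless: the term vanishes identically when p or q does. -/
lemma hasDerivAt_chernoffTerm {p q : ℝ} (s : ℝ) (hp : 0 ≤ p) (hq : 0 ≤ q) :
    HasDerivAt (chernoffTerm p q) (chernoffTerm p q s * (Real.log p - Real.log q)) s := by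
  by_cases h : p = 0 ∨ q = 0
  · have : chernoffTerm p q = fun _ => 0 := funext fun t => chernoffTerm_eq_zero t h
    rw [this]
    simpa using hasDerivAt_const s (0 : ℝ)
  · rw [not_or] at h
    have hp' := lt_of_le_of_ne hp (Ne.symm h.1)
    have hq' := lt_of_le_of_ne hq (Ne.symm h.2)
    have : chernoffTerm p q = fun t => Real.exp (t * Real.log p + (1 - t) * Real.log q) :=
      funext fun t => chernoffTerm_eq_exp t hp' hq'
    rw [this]
    have h1 : HasDerivAt (fun t : ℝ => t * Real.log p + (1 - t) * Real.log q)
        (1 * Real.log p + (-1) * Real.log q) s :=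
      ((hasDerivAt_id s).mul_const _).add (((hasDerivAt_id s).const_sub 1).mul_const _)
    convert h1.exp using 1
    ring

/-! ### Classical Chernoff lower bound -/

/-- First-order optimality on an interval. -/
lemma deriv_mul_sub_nonneg_of_isMinOn {g : ℝ → ℝ} {a b s t d : ℝ} (hs : s ∈ Set.Icc a b)
    (ht : t ∈ Set.Icc a b) (hmin : IsMinOn g (Set.Icc a b) s) (hd : HasDerivAt g d s) :
    0 ≤ (t - s) * d := by
  have h := hmin.localize.hasFDerivWithinAt_nonneg
    hd.hasFDerivAt.hasFDerivWithinAt (y := t - s)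
    (sub_mem_posTangentConeAt_of_segment_subset ((convex_Icc a b).segment_subset hs ht))
  simpa using h

lemma sum_prod_eq_one {X : Type*} [Fintype X] (w : X → ℝ) (hw : ∑ x, w x = 1) (n : ℕ) :
    ∑ x : Fin n → X, ∏ k, w (x k) = 1 := by
  classical
  have := Finset.prod_univ_sum (fun _ : Fin n => (Finset.univ : Finset X)) (fun _ x => w x)
  simp only [hw, Finset.prod_const_one, Fintype.piFinset_univ] at this
  exact this.symm

lemma sum_fin_succ_pi {X : Type*} [Fintype X] (n : ℕ) (F : (Fin (n + 1) → X) → ℝ) :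
    ∑ x, F x = ∑ a, ∑ y : Fin n → X, F (Fin.cons a y) := by
  rw [← (Fin.consEquiv fun _ : Fin (n + 1) => X).sum_comp, Fintype.sum_prod_type]
  rfl

/-- Kills the cross term in the variance computation. -/
lemma sum_prod_mul_sum_eq_zero {X : Type*} [Fintype X] (w l : X → ℝ)
    (hw : ∑ x, w x = 1) (hl : ∑ x, w x * l x = 0)
    (n : ℕ) : ∑ x : Fin n → X, (∏ k, w (x k)) * ∑ k, l (x k) = 0 := by
  induction n with
  | zero => simp
  | succ n ih =>
    rw [sum_fin_succ_pi]
    have h : ∀ a, ∑ y : Fin n → X, (∏ k, w ((Fin.cons a y : Fin (n + 1) → X) k)) *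
        ∑ k, l ((Fin.cons a y : Fin (n + 1) → X) k) = w a * l a := by
      intro a
      simp only [Fin.prod_univ_succ, Fin.sum_univ_succ, Fin.cons_zero, Fin.cons_succ]
      calc _ = w a * l a * ∑ y : Fin n → X, ∏ k, w (y k)
            + w a * ∑ y : Fin n → X, (∏ k, w (y k)) * ∑ k, l (y k) := by
            rw [Finset.mul_sum, Finset.mul_sum, ← Finset.sum_add_distrib]
            exact Finset.sum_congr rfl fun y _ => by ring
        _ = _ := by rw [ih, sum_prod_eq_one w hw]; ring
    simp only [h, hl]

/-- The variance of a sum of `n` independent centred variables. -/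
lemma sum_prod_mul_sum_sq {X : Type*} [Fintype X] (w l : X → ℝ)
    (hw : ∑ x, w x = 1) (hl : ∑ x, w x * l x = 0)
    (n : ℕ) : ∑ x : Fin n → X, (∏ k, w (x k)) * (∑ k, l (x k)) ^ 2
      = n * ∑ x, w x * l x ^ 2 := by
  induction n with
  | zero => simp
  | succ n ih =>
    rw [sum_fin_succ_pi]
    have h : ∀ a, ∑ y : Fin n → X, (∏ k, w ((Fin.cons a y : Fin (n + 1) → X) k)) *
        (∑ k, l ((Fin.cons a y : Fin (n + 1) → X) k)) ^ 2
        = w a * l a ^ 2 + w a * (n * ∑ x, w x * l x ^ 2) := by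
      intro a
      simp only [Fin.prod_univ_succ, Fin.sum_univ_succ, Fin.cons_zero, Fin.cons_succ]
      calc _ = w a * l a ^ 2 * ∑ y : Fin n → X, ∏ k, w (y k)
            + 2 * w a * l a * ∑ y : Fin n → X, (∏ k, w (y k)) * ∑ k, l (y k)
            + w a * ∑ y : Fin n → X, (∏ k, w (y k)) * (∑ k, l (y k)) ^ 2 := by
            rw [Finset.mul_sum, Finset.mul_sum, Finset.mul_sum, ← Finset.sum_add_distrib,
              ← Finset.sum_add_distrib]
            exact Finset.sum_congr rfl fun y _ => by ring
        _ = _ := by rw [ih, sum_prod_eq_one w hw, sum_prod_mul_sum_eq_zero w l hw hl]; ring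
    simp only [h, Finset.sum_add_distrib, ← Finset.sum_mul, hw]
    push_cast
    ring

/-- Pointwise form of the change of measure: with the exponential tilting
`w = p ^ s q ^ (1 - s) / Z` and the centred log-likelihood ratio, the minimum of two product weights
is bounded below by the tilted weight on the typical set. -/
lemma tilted_le_min_prod {X : Type*} (p q : X → ℝ) (hp : ∀ x, 0 ≤ p x)
    (hq : ∀ x, 0 ≤ q x) {s Z m δ : ℝ}
    (hs : s ∈ Set.Icc (0 : ℝ) 1) (hZ : 0 < Z) (hδ : 0 < δ) (hm₁ : 0 ≤ (1 - s) * m)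
    (hm₀ : 0 ≤ (0 - s) * m) {n : ℕ} (hn : 0 < n) (x : Fin n → X) :
    (Z * Real.exp (-δ)) ^ n * ((∏ k, chernoffTerm (p (x k)) (q (x k)) s / Z) *
      (1 - (∑ k, (Real.log (p (x k)) - Real.log (q (x k)) - m)) ^ 2 / (n * δ) ^ 2))
      ≤ min (∏ k, p (x k)) (∏ k, q (x k)) := by
  have hR : 0 ≤ min (∏ k, p (x k)) (∏ k, q (x k)) :=
    le_min (Finset.prod_nonneg fun k _ => hp _) (Finset.prod_nonneg fun k _ => hq _)
  by_cases hz : ∃ k, p (x k) = 0 ∨ q (x k) = 0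
  · obtain ⟨k, hk⟩ := hz
    rw [Finset.prod_eq_zero (Finset.mem_univ k) (by rw [chernoffTerm_eq_zero s hk, zero_div])]
    simpa using hR
  push Not at hz
  have hp' : ∀ k, 0 < p (x k) := fun k => lt_of_le_of_ne (hp _) (hz k).1.symm
  have hq' : ∀ k, 0 < q (x k) := fun k => lt_of_le_of_ne (hq _) (hz k).2.symm
  have hnδ : 0 < n * δ := by positivity
  set S := ∑ k, (Real.log (p (x k)) - Real.log (q (x k)) - m) with hS
  have hw : 0 ≤ ∏ k, chernoffTerm (p (x k)) (q (x k)) s / Z :=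
    Finset.prod_nonneg fun k _ => div_nonneg (chernoffTerm_nonneg _ (hp _) (hq _)) hZ.le
  -- Chebyshev in pointwise form: off the typical set the last factor is nonpositive.
  rcases le_or_gt |S| (n * δ) with hle | hgt
  · have hSabs := abs_le.1 hle
    have hfac : 1 - S ^ 2 / (n * δ) ^ 2 ≤ 1 := by
      have : 0 ≤ S ^ 2 / (n * δ) ^ 2 := by positivity
      linarith
    have hPexp : ∏ k, p (x k) = Real.exp (∑ k, Real.log (p (x k))) := by
      rw [Real.exp_sum]
      exact Finset.prod_congr rfl fun k _ => (Real.exp_log (hp' k)).symm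
    have hQexp : ∏ k, q (x k) = Real.exp (∑ k, Real.log (q (x k))) := by
      rw [Real.exp_sum]
      exact Finset.prod_congr rfl fun k _ => (Real.exp_log (hq' k)).symm
    have hWexp : (Z * Real.exp (-δ)) ^ n * ∏ k, chernoffTerm (p (x k)) (q (x k)) s / Z
        = Real.exp (-(n * δ) + (s * ∑ k, Real.log (p (x k))
            + (1 - s) * ∑ k, Real.log (q (x k)))) := by
      rw [Finset.prod_div_distrib, Finset.prod_const, Finset.card_univ, Fintype.card_fin,
        Finset.prod_congr rfl fun k _ => chernoffTerm_eq_exp s (hp' k) (hq' k), ← Real.exp_sum,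
        mul_pow, ← Real.exp_nat_mul, Finset.sum_add_distrib, ← Finset.mul_sum, ← Finset.mul_sum,
        Real.exp_add (-(n * δ))]
      field_simp
    have hS' : S = ∑ k, Real.log (p (x k)) - ∑ k, Real.log (q (x k)) - n * m := by
      simp [hS, Finset.sum_sub_distrib]
    set A := ∑ k, Real.log (p (x k))
    set B := ∑ k, Real.log (q (x k))
    have hn0 : (0 : ℝ) ≤ n := n.cast_nonneg
    obtain ⟨hs0, hs1⟩ := hs
    -- Since A - B = S + nm, the tilted exponent is below A by (1-s)(S + nm) and below B by -s(S +
    -- nm), up to nδ. The sign conditions on m remove the drift, and |S| ≤ nδ bounds the rest.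
    have hA : -(n * δ) + (s * A + (1 - s) * B) ≤ A := by
      nlinarith [mul_nonneg hn0 hm₁, mul_nonneg (sub_nonneg.2 hs1) (by linarith : 0 ≤ S + n * δ),
        mul_nonneg hs0 hnδ.le]
    have hB : -(n * δ) + (s * A + (1 - s) * B) ≤ B := by
      nlinarith [mul_nonneg hn0 hm₀, mul_nonneg hs0 (by linarith : 0 ≤ n * δ - S),
        mul_nonneg (sub_nonneg.2 hs1) hnδ.le]
    calc _ ≤ (Z * Real.exp (-δ)) ^ n * ((∏ k, chernoffTerm (p (x k)) (q (x k)) s / Z) * 1) := by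
          gcongr
      _ = _ := by rw [mul_one, hWexp]
      _ ≤ _ := by
          rw [hPexp, hQexp]
          exact le_min (Real.exp_le_exp.2 hA) (Real.exp_le_exp.2 hB)
  · refine le_trans (mul_nonpos_of_nonneg_of_nonpos (by positivity)
      (mul_nonpos_of_nonneg_of_nonpos hw ?_)) hR
    rw [sub_nonpos, one_le_div (by positivity), ← sq_abs S]
    gcongr

/-- Chernoff lower bound: if the Chernoff function of two nonnegative weights exceeds `1` on all of
`[0, 1]`, the overlap of their product weights diverges. -/
theorem tendsto_sum_min_prod_atTop {X : Type*} [Fintype X] (p q : X → ℝ)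
    (hp : ∀ x, 0 ≤ p x) (hq : ∀ x, 0 ≤ q x)
    (h : ∀ s ∈ Set.Icc (0 : ℝ) 1, 1 < ∑ x, chernoffTerm (p x) (q x) s) :
    Tendsto (fun n : ℕ => ∑ x : Fin n → X, min (∏ k, p (x k)) (∏ k, q (x k))) atTop atTop := by
  set g : ℝ → ℝ := fun s => ∑ x, chernoffTerm (p x) (q x) s with hg
  have hd : ∀ s, HasDerivAt g
      (∑ x, chernoffTerm (p x) (q x) s * (Real.log (p x) - Real.log (q x))) s := fun s =>
    HasDerivAt.fun_sum fun x _ => hasDerivAt_chernoffTerm s (hp x) (hq x)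
  obtain ⟨s, hs, hmin⟩ := isCompact_Icc.exists_isMinOn (Set.nonempty_Icc.2 zero_le_one)
    (f := g) (s := Set.Icc (0 : ℝ) 1) fun s _ => (hd s).continuousAt.continuousWithinAt
  have hZ1 : 1 < g s := h s hs
  have hZ : 0 < g s := zero_lt_one.trans hZ1
  set w : X → ℝ := fun x => chernoffTerm (p x) (q x) s / g s with hw
  set d := ∑ x, chernoffTerm (p x) (q x) s * (Real.log (p x) - Real.log (q x)) with hdd
  set m := d / g s with hm
  -- m is the tilted mean of the log-likelihood ratio. It vanishes at an interior minimiser; at an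
  -- endpoint only its sign is known, which suffices.
  have hfirst : ∀ t ∈ Set.Icc (0 : ℝ) 1, 0 ≤ (t - s) * m := fun t ht => by
    rw [hm, ← mul_div_assoc]
    exact div_nonneg (deriv_mul_sub_nonneg_of_isMinOn hs ht hmin (hd s)) hZ.le
  set l : X → ℝ := fun x => Real.log (p x) - Real.log (q x) - m with hl
  have hw1 : ∑ x, w x = 1 := by
    rw [hw, ← Finset.sum_div]
    exact div_self hZ.ne'
  have hwl : ∑ x, w x * l x = 0 := by
    have : ∑ x, w x * l x = d / g s - (∑ x, w x) * m := by
      rw [hdd, Finset.sum_div, Finset.sum_mul, ← Finset.sum_sub_distrib]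
      exact Finset.sum_congr rfl fun x _ => by simp only [hw, hl]; ring
    rw [this, hw1, hm, one_mul, sub_self]
  set v := ∑ x, w x * l x ^ 2 with hv
  -- Half of the growth rate log g(s) pays for fluctuations; the other half leaves e^{nδ}.
  set δ := Real.log (g s) / 2 with hδ
  have hδ0 : 0 < δ := half_pos (Real.log_pos hZ1)
  have hZδ : g s * Real.exp (-δ) = Real.exp δ := by
    nth_rewrite 1 [← Real.exp_log hZ]
    rw [← Real.exp_add, hδ]
    congr 1
    ring
  have hlow : ∀ n : ℕ, 0 < n → Real.exp δ ^ n * (1 - v / δ ^ 2 / n)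
      ≤ ∑ x : Fin n → X, min (∏ k, p (x k)) (∏ k, q (x k)) := by
    intro n hn
    have hn' : (n : ℝ) ≠ 0 := by positivity
    calc _ = (g s * Real.exp (-δ)) ^ n * ∑ x : Fin n → X, ((∏ k, w (x k)) *
          (1 - (∑ k, l (x k)) ^ 2 / (n * δ) ^ 2)) := by
          rw [hZδ]
          congr 1
          simp only [mul_sub, mul_one, Finset.sum_sub_distrib, sum_prod_eq_one w hw1,
            ← mul_div_assoc, ← Finset.sum_div, sum_prod_mul_sum_sq w l hw1 hwl]
          rw [← hv]
          field_simp
      _ ≤ _ := by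
          rw [Finset.mul_sum]
          exact Finset.sum_le_sum fun x _ => tilted_le_min_prod p q hp hq hs hZ hδ0
            (hfirst 1 (by simp)) (hfirst 0 (by simp)) hn x
  refine tendsto_atTop_mono' _ ((eventually_gt_atTop 0).mono hlow) ?_
  refine Tendsto.atTop_mul_pos zero_lt_one
    (tendsto_pow_atTop_atTop_of_one_lt (Real.one_lt_exp_iff.2 hδ0)) ?_
  simpa using (tendsto_const_div_atTop_nhds_zero_nat (v / δ ^ 2)).const_sub 1

/-! ### Tests and overlaps of eigenbases -/

section trace
variable {ι κ : Type*} [Fintype ι] [Fintype κ] [DecidableEq ι] [DecidableEq κ]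

lemma trace_diagonal_conjTranspose_mul (A : Matrix κ ι ℂ) (a : ι → ℝ) (b : κ → ℝ) :
    (Matrix.diagonal (fun i => (a i : ℂ)) * A.conjTranspose *
      Matrix.diagonal (fun j => (b j : ℂ)) * A).trace.re
      = ∑ i, ∑ j, a i * b j * ‖A j i‖ ^ 2 := by
  simp only [Matrix.trace, Matrix.diag_apply, Matrix.mul_apply (M := _ * _ * _),
    Matrix.mul_diagonal, Matrix.diagonal_mul, Matrix.conjTranspose_apply, Complex.re_sum]
  refine Finset.sum_congr rfl fun i _ => Finset.sum_congr rfl fun j _ => ?_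
  have : (a i : ℂ) * star (A j i) * (b j : ℂ) * A j i
      = ((a i * b j * ‖A j i‖ ^ 2 : ℝ) : ℂ) := by
    have h := Complex.conj_mul' (A j i)
    push_cast
    rw [← h]
    simp only [Complex.star_def]
    ring
  rw [this, Complex.ofReal_re]

lemma Matrix.PosSemidef.trace_mul_conj_diagonal_nonneg {M : Matrix ι ι ℂ} (hM : M.PosSemidef)
    (U : Matrix ι ι ℂ) {a : ι → ℝ} (ha : ∀ i, 0 ≤ a i) :
    0 ≤ (M * (U * Matrix.diagonal (fun i => (a i : ℂ)) * U.conjTranspose)).trace.re := by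
  have h : (M * (U * Matrix.diagonal (fun i => (a i : ℂ)) * U.conjTranspose)).trace
      = (U.conjTranspose * M * U * Matrix.diagonal (fun i => (a i : ℂ))).trace := by
    rw [← Matrix.mul_assoc, Matrix.trace_mul_comm]
    simp only [Matrix.mul_assoc]
  rw [h, Matrix.trace, Complex.re_sum]
  refine Finset.sum_nonneg fun i _ => ?_
  rw [Matrix.diag_apply, Matrix.mul_diagonal, Complex.re_mul_ofReal]
  exact mul_nonneg (Complex.nonneg_iff.1 ((hM.conjTranspose_mul_mul_same U).diag_nonneg)).1 (ha i)

lemma IsTest.compl {ι : Type*} [DecidableEq ι] {T : Matrix ι ι ℂ} (hT : IsTest T) : IsTest (1 - T) :=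
  ⟨hT.2, by rw [sub_sub_cancel]; exact hT.1⟩

/-- T - T² = T(1-T)T + (1-T)T(1-T). -/
lemma IsTest.sub_mul_self_posSemidef {T : Matrix ι ι ℂ} (hT : IsTest T) :
    (T - T * T).PosSemidef := by
  have h1 := hT.2.conjTranspose_mul_mul_same T
  have h2 := hT.1.conjTranspose_mul_mul_same (1 - T)
  rw [hT.1.isHermitian.eq] at h1
  rw [hT.2.isHermitian.eq] at h2
  convert h1.add h2 using 1
  noncomm_ring

/-- Expanding in the basis V, Σ_j |⟨v_j, T u_i⟩|² = ⟨u_i, T² u_i⟩ ≤ ⟨u_i, T u_i⟩; T need not be a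
projection. -/
lemma IsTest.sum_le_trace {T : Matrix ι ι ℂ} (hT : IsTest T) (U V : Matrix ι ι ℂ)
    (hV : V * V.conjTranspose = 1) {a : ι → ℝ} (ha : ∀ i, 0 ≤ a i) :
    ∑ i, ∑ j, a i * ‖(V.conjTranspose * T * U) j i‖ ^ 2
      ≤ (T * (U * Matrix.diagonal (fun i => (a i : ℂ)) * U.conjTranspose)).trace.re := by
  have h := hT.sub_mul_self_posSemidef.trace_mul_conj_diagonal_nonneg U ha
  rw [Matrix.sub_mul, Matrix.trace_sub, Complex.sub_re, sub_nonneg] at h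
  refine le_trans (le_of_eq ?_) h
  have h2 := trace_diagonal_conjTranspose_mul (V.conjTranspose * T * U) a (fun _ => 1)
  simp only [mul_one] at h2
  rw [← h2]
  congr 1
  simp only [Complex.ofReal_one, Matrix.diagonal_one, Matrix.mul_one, Matrix.conjTranspose_mul,
    Matrix.conjTranspose_conjTranspose, hT.1.isHermitian.eq]
  calc _ = (Matrix.diagonal (fun i => (a i : ℂ)) * U.conjTranspose * T *
        (V * V.conjTranspose) * T * U).trace := by simp only [Matrix.mul_assoc]
    _ = (Matrix.diagonal (fun i => (a i : ℂ)) * U.conjTranspose * (T * T * U)).trace := by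
        rw [hV]; simp only [Matrix.mul_assoc, Matrix.one_mul]
    _ = _ := by rw [Matrix.trace_mul_comm]; simp only [Matrix.mul_assoc]

/-- Nussbaum–Szkoła: the errors of any test between `U diag(l) Uᴴ` and `V diag(m) Vᴴ` dominate half
the overlap of the weights `l i |⟨v_j, u_i⟩|²` and `m j |⟨v_j, u_i⟩|²`. -/
theorem IsTest.sum_min_le {T : Matrix ι ι ℂ} (hT : IsTest T) (U V : Matrix ι ι ℂ)
    (hU : U * U.conjTranspose = 1) (hV : V * V.conjTranspose = 1) {l m : ι → ℝ}
    (hl : ∀ i, 0 ≤ l i) (hm : ∀ j, 0 ≤ m j) {a b : ℝ} (ha : 0 ≤ a) (hb : 0 ≤ b) :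
    ∑ i, ∑ j, min (a * l i) (b * m j) * ‖(V.conjTranspose * U) j i‖ ^ 2
      ≤ 2 * (a * typeIError (U * Matrix.diagonal (fun i => (l i : ℂ)) * U.conjTranspose) T
        + b * typeIIError (V * Matrix.diagonal (fun i => (m i : ℂ)) * V.conjTranspose) T) := by
  have h1 := mul_le_mul_of_nonneg_left (hT.sum_le_trace U V hV hl) ha
  have h2 := mul_le_mul_of_nonneg_left (hT.compl.sum_le_trace V U hU hm) hb
  rw [Finset.sum_comm] at h2
  have hnorm : ∀ i j, ‖(U.conjTranspose * (1 - T) * V) i j‖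
      = ‖(V.conjTranspose * (1 - T) * U) j i‖ := fun i j => by
    have : U.conjTranspose * (1 - T) * V = (V.conjTranspose * (1 - T) * U).conjTranspose := by
      simp only [Matrix.conjTranspose_mul, Matrix.conjTranspose_conjTranspose,
        hT.2.isHermitian.eq, Matrix.mul_assoc]
    rw [this, Matrix.conjTranspose_apply, norm_star]
  simp only [hnorm] at h2
  refine le_trans ?_ (mul_le_mul_of_nonneg_left (add_le_add h1 h2) zero_le_two)
  simp only [Finset.mul_sum, ← Finset.sum_add_distrib]
  refine Finset.sum_le_sum fun i _ => Finset.sum_le_sum fun j _ => ?_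
  -- The overlap splits along T + (1 - T) = 1; the parallelogram bound below is the source of the
  -- factor 2.
  have hsplit : (V.conjTranspose * U) j i
      = (V.conjTranspose * T * U) j i + (V.conjTranspose * (1 - T) * U) j i := by
    rw [← Matrix.add_apply, Matrix.mul_sub, Matrix.mul_one, Matrix.sub_mul, add_sub_cancel]
  set x := (V.conjTranspose * T * U) j i
  set y := (V.conjTranspose * (1 - T) * U) j i
  have hsq : ‖x + y‖ ^ 2 ≤ 2 * (‖x‖ ^ 2 + ‖y‖ ^ 2) := by
    nlinarith [norm_add_le x y, norm_nonneg (x + y), sq_nonneg (‖x‖ - ‖y‖)]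
  have hc : 0 ≤ min (a * l i) (b * m j) :=
    le_min (mul_nonneg ha (hl i)) (mul_nonneg hb (hm j))
  rw [hsplit]
  calc _ ≤ min (a * l i) (b * m j) * (2 * (‖x‖ ^ 2 + ‖y‖ ^ 2)) := by gcongr
    _ = 2 * (min (a * l i) (b * m j) * ‖x‖ ^ 2 + min (a * l i) (b * m j) * ‖y‖ ^ 2) := by ring
    _ ≤ 2 * (a * l i * ‖x‖ ^ 2 + b * m j * ‖y‖ ^ 2) := by
        gcongr
        · exact min_le_left _ _
        · exact min_le_right _ _
    _ = _ := by ring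

lemma trace_conj_diagonal_mul_conj_diagonal (U V : Matrix ι ι ℂ) (a b : ι → ℝ) :
    ((U * Matrix.diagonal (fun i => (a i : ℂ)) * U.conjTranspose) *
      (V * Matrix.diagonal (fun j => (b j : ℂ)) * V.conjTranspose)).trace.re
      = ∑ i, ∑ j, a i * b j * ‖(V.conjTranspose * U) j i‖ ^ 2 := by
  rw [← trace_diagonal_conjTranspose_mul]
  congr 1
  rw [Matrix.mul_assoc U, Matrix.mul_assoc U, Matrix.trace_mul_comm]
  simp only [Matrix.conjTranspose_mul, Matrix.conjTranspose_conjTranspose, Matrix.mul_assoc]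

lemma psdPow_eq_conj_diagonal {A : Matrix ι ι ℂ} (hA : A.IsHermitian) (s : ℝ) :
    psdPow A s = (hA.eigenvectorUnitary : Matrix ι ι ℂ) *
      Matrix.diagonal (fun i => (suppRpow s (hA.eigenvalues i) : ℂ)) *
      (hA.eigenvectorUnitary : Matrix ι ι ℂ).conjTranspose := by
  rw [psdPow, hA.cfc_eq, Matrix.IsHermitian.cfc, Unitary.conjStarAlgAut_apply]
  rfl

lemma Matrix.IsHermitian.eq_conj_diagonal {A : Matrix ι ι ℂ} (hA : A.IsHermitian) :
    A = (hA.eigenvectorUnitary : Matrix ι ι ℂ) *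
      Matrix.diagonal (fun i => (hA.eigenvalues i : ℂ)) *
      (hA.eigenvectorUnitary : Matrix ι ι ℂ).conjTranspose := by
  conv_lhs => rw [hA.spectral_theorem, Unitary.conjStarAlgAut_apply]
  rfl

lemma Matrix.IsHermitian.eigenvectorUnitary_mul_conjTranspose {A : Matrix ι ι ℂ}
    (hA : A.IsHermitian) : (hA.eigenvectorUnitary : Matrix ι ι ℂ) *
      (hA.eigenvectorUnitary : Matrix ι ι ℂ).conjTranspose = 1 :=
  Unitary.mul_star_self_of_mem hA.eigenvectorUnitary.2

end trace

/-! ### Tensor powers and the reduction to classical weights -/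

lemma tensorPower_mul {ι : Type*} [Fintype ι] (n : ℕ) (A B : Matrix ι ι ℂ) :
    tensorPower (A * B) n = tensorPower A n * tensorPower B n := by
  classical
  ext f g
  simp only [tensorPower, Matrix.of_apply, Matrix.mul_apply, ← Finset.prod_mul_distrib]
  rw [Finset.prod_univ_sum, Fintype.piFinset_univ]

lemma tensorPower_conjTranspose {ι : Type*} (n : ℕ) (A : Matrix ι ι ℂ) :
    tensorPower A.conjTranspose n = (tensorPower A n).conjTranspose := by
  ext f g
  simp [tensorPower, Matrix.conjTranspose_apply]

lemma tensorPower_diagonal {ι : Type*} [DecidableEq ι] (n : ℕ) (d : ι → ℝ) :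
    tensorPower (Matrix.diagonal fun i => (d i : ℂ)) n
      = Matrix.diagonal fun f => ((∏ k, d (f k) : ℝ) : ℂ) := by
  ext f g
  simp only [tensorPower, Matrix.of_apply]
  by_cases h : f = g
  · subst h
    simp
  · obtain ⟨k, hk⟩ := Function.ne_iff.1 h
    rw [Matrix.diagonal_apply_ne _ h, Finset.prod_eq_zero (Finset.mem_univ k)]
    exact Matrix.diagonal_apply_ne _ hk

lemma tensorPower_one {ι : Type*} [DecidableEq ι] (n : ℕ) : tensorPower (1 : Matrix ι ι ℂ) n = 1 := by
  have h := tensorPower_diagonal n (fun _ : ι => (1 : ℝ))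
  simpa using h

/-- Lets the common factor |⟨v_j, u_i⟩|² leave the Chernoff term with exponent one, even at s = 0,
1. -/
lemma suppRpow_mul_suppRpow_one_sub {x : ℝ} (s : ℝ) (hx : 0 ≤ x) :
    suppRpow s x * suppRpow (1 - s) x = x := by
  unfold suppRpow
  split_ifs with h
  · simp [h]
  · rw [← Real.rpow_add (lt_of_le_of_ne hx (Ne.symm h)), add_sub_cancel, Real.rpow_one]

lemma psdPow_one {ι : Type*} [Fintype ι] [DecidableEq ι] {A : Matrix ι ι ℂ}
    (hA : A.IsHermitian) : psdPow A 1 = A := by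
  conv_rhs => rw [hA.eq_conj_diagonal]
  rw [psdPow_eq_conj_diagonal hA]
  congr 4
  ext i
  simp +contextual [suppRpow]

/-- Reduction of a pair of positive semidefinite matrices to a classical pair of weights with the
same Chernoff function, whose product overlaps bound the errors of every test on tensor powers. -/
theorem exists_nussbaumSzkola_weights {ι : Type*} [Fintype ι] [DecidableEq ι]
    {ρ σ : Matrix ι ι ℂ} (hρ : ρ.PosSemidef) (hσ : σ.PosSemidef) :
    ∃ p q : ι × ι → ℝ, (∀ x, 0 ≤ p x) ∧ (∀ x, 0 ≤ q x) ∧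
      (∀ s, (psdPow ρ s * psdPow σ (1 - s)).trace.re = ∑ x, chernoffTerm (p x) (q x) s) ∧
      ∀ (n : ℕ) (T : Matrix (Fin n → ι) (Fin n → ι) ℂ) (a b : ℝ), IsTest T → 0 ≤ a → 0 ≤ b →
        ∑ x : Fin n → ι × ι, min (a * ∏ k, p (x k)) (b * ∏ k, q (x k))
          ≤ 2 * (a * typeIError (tensorPower ρ n) T + b * typeIIError (tensorPower σ n) T) := by
  set U : Matrix ι ι ℂ := hρ.isHermitian.eigenvectorUnitary.1 with hU
  set V : Matrix ι ι ℂ := hσ.isHermitian.eigenvectorUnitary.1 with hV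
  set l := hρ.isHermitian.eigenvalues with hl
  set m := hσ.isHermitian.eigenvalues with hm
  have hl0 : ∀ i, 0 ≤ l i := hρ.eigenvalues_nonneg
  have hm0 : ∀ i, 0 ≤ m i := hσ.eigenvalues_nonneg
  set w : ι × ι → ℝ := fun x => ‖(V.conjTranspose * U) x.2 x.1‖ ^ 2 with hw
  have hw0 : ∀ x, 0 ≤ w x := fun x => by positivity
  refine ⟨fun x => l x.1 * w x, fun x => m x.2 * w x, fun x => mul_nonneg (hl0 _) (hw0 _),
    fun x => mul_nonneg (hm0 _) (hw0 _), fun s => ?_, fun n T a b hT ha hb => ?_⟩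
  · rw [psdPow_eq_conj_diagonal hρ.isHermitian, psdPow_eq_conj_diagonal hσ.isHermitian,
      trace_conj_diagonal_mul_conj_diagonal, Fintype.sum_prod_type]
    refine Finset.sum_congr rfl fun i _ => Finset.sum_congr rfl fun j _ => ?_
    rw [chernoffTerm, suppRpow_mul _ (hl0 _) (hw0 _), suppRpow_mul _ (hm0 _) (hw0 _),
      mul_mul_mul_comm, suppRpow_mul_suppRpow_one_sub _ (hw0 _)]
  · have hUn : tensorPower U n * (tensorPower U n).conjTranspose = 1 := by
      rw [← tensorPower_conjTranspose, ← tensorPower_mul,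
        hρ.isHermitian.eigenvectorUnitary_mul_conjTranspose, tensorPower_one]
    have hVn : tensorPower V n * (tensorPower V n).conjTranspose = 1 := by
      rw [← tensorPower_conjTranspose, ← tensorPower_mul,
        hσ.isHermitian.eigenvectorUnitary_mul_conjTranspose, tensorPower_one]
    have h := hT.sum_min_le (tensorPower U n) (tensorPower V n) hUn hVn
      (l := fun f => ∏ k, l (f k)) (m := fun f => ∏ k, m (f k))
      (fun f => Finset.prod_nonneg fun k _ => hl0 _)
      (fun f => Finset.prod_nonneg fun k _ => hm0 _) ha hb
    rw [← tensorPower_diagonal, ← tensorPower_diagonal, ← tensorPower_conjTranspose,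
      ← tensorPower_conjTranspose, ← tensorPower_mul, ← tensorPower_mul, ← tensorPower_mul,
      ← tensorPower_mul, ← tensorPower_mul, ← hρ.isHermitian.eq_conj_diagonal,
      ← hσ.isHermitian.eq_conj_diagonal] at h
    refine le_trans (le_of_eq ?_) h
    -- Pairs of strings become strings of pairs, so the overlaps for tensor powers are products of
    -- single-copy ones.
    rw [← Fintype.sum_prod_type', ← (Equiv.arrowProdEquivProdArrow (Fin n) (fun _ => ι)
      (fun _ => ι)).sum_comp]
    refine Finset.sum_congr rfl fun x _ => ?_
    have hprod : ‖tensorPower (V.conjTranspose * U) n (fun k => (x k).2) (fun k => (x k).1)‖ ^ 2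
        = ∏ k, w (x k) := by
      simp only [tensorPower, Matrix.of_apply, norm_prod, hw, Finset.prod_pow]
    change _ = min (a * ∏ k, l (x k).1) (b * ∏ k, m (x k).2) *
      ‖tensorPower (V.conjTranspose * U) n (fun k => (x k).2) (fun k => (x k).1)‖ ^ 2
    rw [hprod, min_mul_of_nonneg _ _ (Finset.prod_nonneg fun k _ => hw0 _),
      Finset.prod_mul_distrib, Finset.prod_mul_distrib, mul_assoc, mul_assoc]

/-! ### From the exponent to the error bound -/

/-- If the Hoeffding exponent of a nonnegative Chernoff function is less than `z`, the corresponding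
affinely rescaled Chernoff function exceeds `1` at the given `s < 1`. -/
lemma one_lt_exp_mul_of_hoeffding_lt {s r z g : ℝ} (hs : s < 1)
    (h : ((1 / (s - 1) : ℝ) : EReal) * extLog g + ((s / (s - 1) * r : ℝ) : EReal) < z) :
    1 < Real.exp (s * r + (1 - s) * z) * g := by
  have hs' : s - 1 < 0 := by linarith
  rcases le_or_gt g 0 with hg | hg
  -- Here log g = -∞ has a negative coefficient, so the exponent would be +∞.
  · rw [extLog, ENNReal.log_ofReal, if_pos hg,
      EReal.coe_mul_bot_of_neg (one_div_neg.2 hs'), EReal.top_add_coe] at h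
    exact absurd h not_top_lt
  · rw [extLog, ENNReal.log_ofReal_of_pos hg, ← EReal.coe_mul, ← EReal.coe_add,
      EReal.coe_lt_coe_iff] at h
    have h1 : 0 < s * r + (1 - s) * z + Real.log g := by
      have : 1 / (s - 1) * Real.log g + s / (s - 1) * r = (Real.log g + s * r) / (s - 1) := by
        ring
      rw [this, div_lt_iff_of_neg hs'] at h
      linarith
    calc 1 < Real.exp (s * r + (1 - s) * z + Real.log g) := Real.one_lt_exp_iff.2 h1
      _ = _ := by rw [Real.exp_add, Real.exp_log hg]

lemma zero_isTest {ι : Type*} [DecidableEq ι] : IsTest (0 : Matrix ι ι ℂ) :=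
  ⟨Matrix.PosSemidef.zero, by rw [sub_zero]; exact Matrix.PosSemidef.one⟩

lemma le_optimalTypeII {ι : Type*} [Fintype ι] [DecidableEq ι] {α c : ℝ} {ρ σ : Matrix ι ι ℂ}
    (hα : 0 ≤ α) (h : ∀ T, IsTest T → typeIError ρ T ≤ α → c ≤ typeIIError σ T) :
    c ≤ optimalTypeII α ρ σ := by
  -- The zero test makes the set nonempty; the real infimum of the empty set would be the default 0.
  refine le_csInf ⟨_, 0, zero_isTest, by simpa [typeIError] using hα, rfl⟩ ?_
  rintro _ ⟨T, hT, hTα, rfl⟩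
  exact h T hT hTα

lemma hypTestEntropy_le {ι : Type*} [Fintype ι] [DecidableEq ι] {α c : ℝ} {ρ σ : Matrix ι ι ℂ}
    (h : Real.exp (-c) ≤ optimalTypeII α ρ σ) : hypTestEntropy α ρ σ ≤ c := by
  have h1 : ((-c : ℝ) : EReal) ≤ extLog (optimalTypeII α ρ σ) := by
    rw [← Real.log_exp (-c), ← ENNReal.log_ofReal_of_pos (Real.exp_pos _)]
    exact ENNReal.log_monotone (ENNReal.ofReal_le_ofReal h)
  rw [hypTestEntropy, EReal.neg_le, ← EReal.coe_neg]
  exact h1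

theorem corollary3 {ι : Type*} [Fintype ι] [DecidableEq ι]
    (ρ σ : Matrix ι ι ℂ) (hρ : IsDensityOperator ρ) (hσ : IsDensityOperator σ)
    (r : ℝ) (hr : (ρ * supportProj σ).trace.re ≠ Real.exp (-r))
    (ε : ℕ → ℝ) (hε₀ : ∀ n, 0 ≤ ε n) (hε : ∀ n : ℕ, ε n ≤ Real.exp (-(n * r))) :
    limsup (fun n : ℕ => ((1 / (n : ℝ) : ℝ) : EReal) *
        hypTestEntropy (ε n) (tensorPower ρ n) (tensorPower σ n)) atTop
      ≤ hoeffdingExponent ρ σ r := by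
  obtain ⟨p, q, hp, hq, htr, htest⟩ := exists_nussbaumSzkola_weights hρ.1 hσ.1
  refine EReal.le_of_forall_lt_iff_le.1 fun z hz => ?_
  set g : ℝ → ℝ := fun s => ∑ x, chernoffTerm (p x) (q x) s with hg
  have hcont : Continuous fun s => Real.exp (s * r + (1 - s) * z) * g s := by
    have : Continuous g := continuous_finsetSum _ fun x _ => continuous_iff_continuousAt.2
      fun s => (hasDerivAt_chernoffTerm s (hp x) (hq x)).continuousAt
    fun_prop
  have hlt : ∀ s ∈ Set.Ico (0 : ℝ) 1, 1 < Real.exp (s * r + (1 - s) * z) * g s := by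
    intro s hs
    have h := (le_iSup₂ (f := fun s (_ : s ∈ Set.Ico (0 : ℝ) 1) =>
      ((1 / (s - 1) : ℝ) : EReal) * extLog (psdPow ρ s * psdPow σ (1 - s)).trace.re
        + ((s / (s - 1) * r : ℝ) : EReal)) s hs).trans_lt hz
    rw [htr] at h
    exact one_lt_exp_mul_of_hoeffding_lt hs.2 h
  -- The supremum omits s = 1, so strictness there must come from `hr`.
  have hone : 1 < Real.exp (1 * r + (1 - 1) * z) * g 1 := by
    refine lt_of_le_of_ne ?_ fun h => hr ?_
    · have hmem : (1 : ℝ) ∈ closure (Set.Ico (0 : ℝ) 1) := by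
        rw [closure_Ico zero_ne_one]
        simp
      exact closure_minimal (fun s hs => (hlt s hs).le) (isClosed_le continuous_const hcont) hmem
    · have h1 := htr 1
      rw [psdPow_one hρ.1.isHermitian, sub_self] at h1
      rw [supportProj, h1, Real.exp_neg]
      refine eq_inv_of_mul_eq_one_right ?_
      simpa [hg] using h.symm
  have hall : ∀ s ∈ Set.Icc (0 : ℝ) 1,
      1 < ∑ x, chernoffTerm (Real.exp r * p x) (Real.exp z * q x) s := by
    intro s hs
    have h : ∑ x, chernoffTerm (Real.exp r * p x) (Real.exp z * q x) s
        = Real.exp (s * r + (1 - s) * z) * g s := by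
      rw [hg, Finset.mul_sum]
      refine Finset.sum_congr rfl fun x _ => ?_
      rw [chernoffTerm_mul s (Real.exp_pos _) (Real.exp_pos _) (hp x) (hq x), ← Real.exp_mul,
        ← Real.exp_mul, ← Real.exp_add, mul_comm r, mul_comm z]
    rw [h]
    rcases hs.2.lt_or_eq with h1 | h1
    · exact hlt s ⟨hs.1, h1⟩
    · rw [h1]
      exact hone
  have hdiv := tendsto_sum_min_prod_atTop _ _ (fun x => mul_nonneg (Real.exp_pos r).le (hp x))
    (fun x => mul_nonneg (Real.exp_pos z).le (hq x)) hall
  refine limsup_le_of_le (h := ?_)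
  -- 4 = 2(1 + 1): the weighted type-I error takes at most 1, leaving at least 1 for type II.
  filter_upwards [hdiv.eventually_ge_atTop 4, eventually_gt_atTop 0] with n hn hn0
  have hn0' : (0 : ℝ) < n := by exact_mod_cast hn0
  have hβ : hypTestEntropy (ε n) (tensorPower ρ n) (tensorPower σ n) ≤ ((n * z : ℝ) : EReal) := by
    refine hypTestEntropy_le (le_optimalTypeII (hε₀ n) fun T hT hTε => ?_)
    have h := htest n T (Real.exp (n * r)) (Real.exp (n * z)) hT (Real.exp_pos _).le
      (Real.exp_pos _).le
    simp only [Finset.prod_mul_distrib, Finset.prod_const, Finset.card_univ, Fintype.card_fin,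
      ← Real.exp_nat_mul] at hn
    have hα : Real.exp (n * r) * typeIError (tensorPower ρ n) T ≤ 1 := by
      calc _ ≤ Real.exp (n * r) * Real.exp (-(n * r)) := by
            gcongr
            exact hTε.trans (hε n)
        _ = 1 := by rw [← Real.exp_add, add_neg_cancel, Real.exp_zero]
    rw [Real.exp_neg, inv_le_iff_one_le_mul₀ (Real.exp_pos _), mul_comm]
    linarith
  calc _ ≤ ((1 / (n : ℝ) : ℝ) : EReal) * ((n * z : ℝ) : EReal) :=
        mul_le_mul_of_nonneg_left hβ (EReal.coe_nonneg.2 (by positivity))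
    _ = z := by
        rw [← EReal.coe_mul]
        congr 1
        field_simp
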